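/- A skew (left) brace is a set $B$ with two operations $+$ and $\cdot$ such that $(B,+)$ and $(B,\cdot)$ are groups (neither assumed commutative) and $x(y+z)=xy-x+xz$ for all $x,y,z\in B$; both groups have the same identity element $0$. Put $\lambda_a(b)=-a+ab$; then $\lambda$ is a homomorphism $(B,\cdot)\to\operatorname{Aut}(B,+)$. A subbrace of $B$ is a subset that is a subgroup of both $(B,+)$ and $(B,\cdot)$. An ideal of $B$ is a subbrace $I$ that is normal in $(B,+)$ and in $(B,\cdot)$ and satisfies $\lambda_b(I)\subseteq I$ for all $b\in B$; then $I$ is itself a skew brace, and the cosets $b+I=bI$ form the quotient skew brace $B/I$. Let $$\operatorname{Soc}(B)=\operatorname{Ker}\lambda\cap Z(B,+),\qquad \zeta(B)=\operatorname{Soc}(B)\cap Z(B,\cdot),$$ which are ideals of $B$. Define ideals $\zeta_n(B)$ by $\zeta_0(B)=\{0\}$ and $\zeta_{n+1}(B)/\zeta_n(B)=\zeta(B/\zeta_n(B))$. The skew brace $B$ is centrally nilpotent if $B=\zeta_m(B)$ for some integer $m\ge 0$. An ideal of $B$ is called centrally nilpotent if it is centrally nilpotent as a skew brace. An ideal $I$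 of $B$ is $B$-centrally nilpotent if there is a finite chain $\{0\}=I_0\le I_1\le\dots\le I_n=I$ of ideals of $B$ such that $I_{i+1}/I_i\le\zeta(I/I_i)$ for all $0\le i<n$. The sum of a family of ideals of $B$ is the subgroup of $(B,+)$ generated by their union, which is an ideal of $B$. The Fitting ideal $\operatorname{Fit}(B)$ is the sum of all $B$-centrally nilpotent ideals of $B$. The skew brace $B$ is supersoluble if there is a finite chain $\{0\}=I_0\le I_1\le\dots\le I_n=B$ of ideals of $B$ such that, for every $0\le i<n$, either $(I_{i+1}/I_i,+)$ is infinite cyclic and $I_{i+1}/I_i\le\operatorname{Soc}(B/I_i)$, or $I_{i+1}/I_i$ has prime order. **Theorem.** Let $B$ be a supersoluble skew brace. Then: 1. every centrally nilpotent ideal of $B$ is $B$-centrally nilpotent; 2. the Fitting ideal $\operatorname{Fit}(B)$ is centrally nilpotent; 3. $\operatorname{Fit}(B)$ is equal to the sum of all centrally nilpotent ideals of $B$. -/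

import Mathlib

/-- A skew (left) brace: two group structures on the same set, linked by the skew distributive law
`x (y + z) = x y - x + x z`. The additive group is not assumed to be commutative. -/
class SkewBrace (B : Type*) extends AddGroup B, Group B where
  mul_add_skew : ∀ x y z : B, x * (y + z) = x * y - x + x * z

namespace SkewBrace

variable {B : Type*} [SkewBrace B]

/-- The map `λ_a(b) = -a + ab`. -/
def lam (a b : B) : B := -a + a * b

theorem one_eq_zero : (1 : B) = 0 := by
  have h := mul_add_skew (1 : B) 0 0
  simp only [one_mul, add_zero, zero_sub] at h
  rw [eq_comm, neg_eq_zero] at h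
  exact h

theorem mul_zero' (a : B) : a * 0 = a := by rw [← one_eq_zero, mul_one]

theorem zero_mul' (a : B) : 0 * a = a := by rw [← one_eq_zero, one_mul]

theorem mul_eq (a b : B) : a * b = a + lam a b := by simp [lam]

theorem lam_add (a b c : B) : lam a (b + c) = lam a b + lam a c := by
  simp [lam, mul_add_skew, sub_eq_add_neg, add_assoc]

theorem lam_zero (a : B) : lam a 0 = 0 := by simp [lam, mul_zero']

theorem lam_neg (a b : B) : lam a (-b) = -lam a b := by
  apply eq_neg_of_add_eq_zero_left
  rw [← lam_add, neg_add_cancel, lam_zero]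

theorem lam_mul (a b c : B) : lam (a * b) c = lam a (lam b c) := by
  rw [show lam b c = -b + b * c from rfl, lam_add, lam_neg]
  simp [lam, mul_assoc]

theorem lam_one (a : B) : lam 1 a = a := by simp [lam, one_eq_zero, zero_mul']

theorem add_eq (a b : B) : a + b = a * lam a⁻¹ b := by
  rw [mul_eq, ← lam_mul, mul_inv_cancel, lam_one]

theorem neg_add_eq_lam (a b : B) : -a + b = lam a (a⁻¹ * b) := by simp [lam]

theorem inv_mul_eq_lam (a b : B) : a⁻¹ * b = lam a⁻¹ (-a + b) := by
  rw [neg_add_eq_lam, ← lam_mul, inv_mul_cancel, lam_one]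

theorem inv_eq (a : B) : a⁻¹ = -lam a⁻¹ a := by
  have h := inv_mul_eq_lam a 0
  rwa [mul_zero', add_zero, lam_neg] at h

end SkewBrace

/-- A subbrace: a subset that is a subgroup for both operations. -/
structure Subbrace (B : Type*) [SkewBrace B] extends AddSubgroup B, Subgroup B

namespace Subbrace

variable {B : Type*} [SkewBrace B]

instance : SetLike (Subbrace B) B where
  coe S := S.carrier
  coe_injective S T h := by
    obtain ⟨⟨⟨⟨_, _⟩, _⟩, _⟩, _, _, _⟩ := S
    obtain ⟨⟨⟨⟨_, _⟩, _⟩, _⟩, _, _, _⟩ := T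
    cases h
    rfl

instance (S : Subbrace B) : Zero S := ⟨⟨0, S.zero_mem'⟩⟩
instance (S : Subbrace B) : One S := ⟨⟨1, S.one_mem'⟩⟩
instance (S : Subbrace B) : Add S := ⟨fun a b => ⟨a + b, S.add_mem' a.2 b.2⟩⟩
instance (S : Subbrace B) : Mul S := ⟨fun a b => ⟨a * b, S.mul_mem' a.2 b.2⟩⟩
instance (S : Subbrace B) : Neg S := ⟨fun a => ⟨-a, S.neg_mem' a.2⟩⟩
instance (S : Subbrace B) : Inv S := ⟨fun a => ⟨(a : B)⁻¹, S.inv_mem' a.2⟩⟩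

/-- A subbrace is a skew brace with the restricted operations. -/
instance (S : Subbrace B) : SkewBrace S where
  toAddGroup := AddGroup.ofLeftAxioms
    (fun a b c => Subtype.ext (add_assoc (a : B) b c))
    (fun a => Subtype.ext (zero_add (a : B)))
    (fun a => Subtype.ext (neg_add_cancel (a : B)))
  toGroup := Group.ofLeftAxioms
    (fun a b c => Subtype.ext (mul_assoc (a : B) b c))
    (fun a => Subtype.ext (one_mul (a : B)))
    (fun a => Subtype.ext (inv_mul_cancel (a : B)))
  mul_add_skew a b c := Subtype.ext (by
    have h := SkewBrace.mul_add_skew (a : B) b c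
    rw [sub_eq_add_neg] at h
    exact h)

end Subbrace

open SkewBrace

/-- An ideal of a skew brace `B`: a subbrace that is `λ`-invariant and normal in both `(B,+)` and
`(B,·)`. -/
structure BraceIdeal (B : Type*) [SkewBrace B] extends Subbrace B where
  lam_mem' : ∀ (b : B) {x : B}, x ∈ carrier → lam b x ∈ carrier
  add_conj_mem' : ∀ (b : B) {x : B}, x ∈ carrier → b + x + -b ∈ carrier
  mul_conj_mem' : ∀ (b : B) {x : B}, x ∈ carrier → b * x * b⁻¹ ∈ carrier

namespace BraceIdeal

variable {B : Type*} [SkewBrace B]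

instance : SetLike (BraceIdeal B) B where
  coe S := S.carrier
  coe_injective S T h := by
    obtain ⟨S, _, _, _⟩ := S
    obtain ⟨T, _, _, _⟩ := T
    have : S = T := SetLike.coe_injective h
    cases this
    rfl

/-- Ideals are ordered by inclusion. -/
instance : PartialOrder (BraceIdeal B) := PartialOrder.ofSetLike (BraceIdeal B) B

theorem zero_mem (I : BraceIdeal B) : (0 : B) ∈ I := I.zero_mem'
theorem add_mem (I : BraceIdeal B) {x y : B} (hx : x ∈ I) (hy : y ∈ I) : x + y ∈ I :=
  I.add_mem' hx hy
theorem neg_mem (I : BraceIdeal B) {x : B} (hx : x ∈ I) : -x ∈ I := I.neg_mem' hx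
theorem mul_mem (I : BraceIdeal B) {x y : B} (hx : x ∈ I) (hy : y ∈ I) : x * y ∈ I :=
  I.mul_mem' hx hy
theorem inv_mem (I : BraceIdeal B) {x : B} (hx : x ∈ I) : x⁻¹ ∈ I := I.inv_mem' hx
theorem lam_mem (I : BraceIdeal B) (b : B) {x : B} (hx : x ∈ I) : lam b x ∈ I := I.lam_mem' b hx
theorem add_conj_mem (I : BraceIdeal B) (b : B) {x : B} (hx : x ∈ I) : b + x + -b ∈ I :=
  I.add_conj_mem' b hx
theorem mul_conj_mem (I : BraceIdeal B) (b : B) {x : B} (hx : x ∈ I) : b * x * b⁻¹ ∈ I :=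
  I.mul_conj_mem' b hx

/-- Constructor of ideals: a normal subgroup `S` of `(B,+)` that is `λ`-invariant and stable under
multiplicative conjugation is automatically a subgroup of `(B,·)`. -/
def ofAddSubgroup (S : AddSubgroup B) (h1 : ∀ (b : B) {x : B}, x ∈ S → lam b x ∈ S)
    (h2 : ∀ (b : B) {x : B}, x ∈ S → b + x + -b ∈ S)
    (h3 : ∀ (b : B) {x : B}, x ∈ S → b * x * b⁻¹ ∈ S) : BraceIdeal B where
  toAddSubgroup := S
  mul_mem' {a b} ha hb := by
    rw [mul_eq]
    exact S.add_mem ha (h1 a hb)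
  one_mem' := by
    rw [one_eq_zero]
    exact S.zero_mem
  inv_mem' {a} ha := by
    rw [inv_eq]
    exact S.neg_mem (h1 _ ha)
  lam_mem' b _ hx := h1 b hx
  add_conj_mem' b _ hx := h2 b hx
  mul_conj_mem' b _ hx := h3 b hx

/-- The zero ideal. -/
instance : Bot (BraceIdeal B) := ⟨ofAddSubgroup ⊥
  (by rintro b x hx; rw [AddSubgroup.mem_bot] at *; rw [hx, lam_zero])
  (by rintro b x hx; rw [AddSubgroup.mem_bot] at *; simp [hx])
  (by rintro b x hx; rw [AddSubgroup.mem_bot] at *; rw [hx, mul_zero', mul_inv_cancel, one_eq_zero])⟩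

/-- The ideal `B` of `B`. -/
instance : Top (BraceIdeal B) := ⟨ofAddSubgroup ⊤
  (fun _ _ _ => trivial) (fun _ _ _ => trivial) (fun _ _ _ => trivial)⟩

/-! ### Quotients -/

instance addNormal (I : BraceIdeal B) : I.toAddSubgroup.Normal :=
  ⟨fun _ hx b => I.add_conj_mem b hx⟩

theorem neg_add_mem_iff (I : BraceIdeal B) (a b : B) : -a + b ∈ I ↔ a⁻¹ * b ∈ I := by
  constructor
  · intro h
    rw [inv_mul_eq_lam]
    exact I.lam_mem _ h
  · intro h
    rw [neg_add_eq_lam]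
    exact I.lam_mem _ h

/-- The underlying set of the quotient brace `B/I`: the set of cosets `b + I = bI`. -/
def Quotient (I : BraceIdeal B) : Type _ := B ⧸ I.toAddSubgroup

/-- The projection `B → B/I`. -/
def proj (I : BraceIdeal B) (b : B) : I.Quotient := QuotientAddGroup.mk b

theorem proj_eq_proj (I : BraceIdeal B) {a b : B} : I.proj a = I.proj b ↔ -a + b ∈ I :=
  QuotientAddGroup.eq

theorem proj_surjective (I : BraceIdeal B) : Function.Surjective I.proj :=
  QuotientAddGroup.mk_surjective

instance (I : BraceIdeal B) : AddGroup I.Quotient :=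
  inferInstanceAs (AddGroup (B ⧸ I.toAddSubgroup))

theorem proj_add (I : BraceIdeal B) (a b : B) : I.proj (a + b) = I.proj a + I.proj b := rfl

theorem proj_neg (I : BraceIdeal B) (a : B) : I.proj (-a) = -I.proj a := rfl

theorem proj_zero (I : BraceIdeal B) : I.proj 0 = 0 := rfl

instance (I : BraceIdeal B) : Mul I.Quotient where
  mul := _root_.Quotient.map₂ (· * ·) (by
    intro a a' ha b b' hb
    have ha : a⁻¹ * a' ∈ I := (I.neg_add_mem_iff a a').1 (QuotientAddGroup.leftRel_apply.1 ha)
    have hb : b⁻¹ * b' ∈ I := (I.neg_add_mem_iff b b').1 (QuotientAddGroup.leftRel_apply.1 hb)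
    refine QuotientAddGroup.leftRel_apply.2 ((I.neg_add_mem_iff (a * b) (a' * b')).2 ?_)
    have h := I.mul_mem (I.mul_conj_mem b⁻¹ ha) hb
    have e : (a * b)⁻¹ * (a' * b') = b⁻¹ * (a⁻¹ * a') * b⁻¹⁻¹ * (b⁻¹ * b') := by group
    rw [e]
    exact h)

instance (I : BraceIdeal B) : One I.Quotient := ⟨I.proj 1⟩

instance (I : BraceIdeal B) : Inv I.Quotient where
  inv := _root_.Quotient.map (·⁻¹) (by
    intro a a' ha
    have ha : a⁻¹ * a' ∈ I := (I.neg_add_mem_iff a a').1 (QuotientAddGroup.leftRel_apply.1 ha)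
    refine QuotientAddGroup.leftRel_apply.2 ((I.neg_add_mem_iff a⁻¹ a'⁻¹).2 ?_)
    have h := I.inv_mem (I.mul_conj_mem a ha)
    have e : a⁻¹⁻¹ * a'⁻¹ = (a * (a⁻¹ * a') * a⁻¹)⁻¹ := by group
    rw [e]
    exact h)

theorem proj_mul (I : BraceIdeal B) (a b : B) : I.proj (a * b) = I.proj a * I.proj b := rfl

theorem proj_inv (I : BraceIdeal B) (a : B) : I.proj a⁻¹ = (I.proj a)⁻¹ := rfl

theorem proj_one (I : BraceIdeal B) : I.proj 1 = 1 := rfl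

/-- The quotient brace `B/I`, with the operations induced by those of `B`. -/
instance (I : BraceIdeal B) : SkewBrace I.Quotient where
  toGroup := Group.ofLeftAxioms
    (by
      intro a b c
      obtain ⟨a, rfl⟩ := I.proj_surjective a
      obtain ⟨b, rfl⟩ := I.proj_surjective b
      obtain ⟨c, rfl⟩ := I.proj_surjective c
      simp only [← proj_mul, mul_assoc])
    (by
      intro a
      obtain ⟨a, rfl⟩ := I.proj_surjective a
      simp only [← proj_mul, ← proj_one, one_mul])
    (by
      intro a
      obtain ⟨a, rfl⟩ := I.proj_surjective a
      simp only [← proj_mul, ← proj_one, ← proj_inv, inv_mul_cancel])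
  mul_add_skew a b c := by
    obtain ⟨a, rfl⟩ := I.proj_surjective a
    obtain ⟨b, rfl⟩ := I.proj_surjective b
    obtain ⟨c, rfl⟩ := I.proj_surjective c
    have h := congrArg I.proj (SkewBrace.mul_add_skew a b c)
    rw [sub_eq_add_neg] at h ⊢
    exact h

/-- The image `(J + I)/I` of an ideal `J` of `B` in `B/I`; it is `J/I` when `I ≤ J`. -/
def factor (J I : BraceIdeal B) : BraceIdeal I.Quotient :=
  ofAddSubgroup
    { carrier := I.proj '' (J : Set B)
      zero_mem' := ⟨0, J.zero_mem, rfl⟩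
      add_mem' := by
        rintro _ _ ⟨a, ha, rfl⟩ ⟨b, hb, rfl⟩
        exact ⟨a + b, J.add_mem ha hb, rfl⟩
      neg_mem' := by
        rintro _ ⟨a, ha, rfl⟩
        exact ⟨-a, J.neg_mem ha, rfl⟩ }
    (by
      rintro b _ ⟨x, hx, rfl⟩
      obtain ⟨b, rfl⟩ := I.proj_surjective b
      exact ⟨lam b x, J.lam_mem b hx, rfl⟩)
    (by
      rintro b _ ⟨x, hx, rfl⟩
      obtain ⟨b, rfl⟩ := I.proj_surjective b
      exact ⟨b + x + -b, J.add_conj_mem b hx, rfl⟩)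
    (by
      rintro b _ ⟨x, hx, rfl⟩
      obtain ⟨b, rfl⟩ := I.proj_surjective b
      exact ⟨b * x * b⁻¹, J.mul_conj_mem b hx, rfl⟩)

/-- The preimage in `B` of an ideal of `B/I`. -/
def preimage (I : BraceIdeal B) (K : BraceIdeal I.Quotient) : BraceIdeal B :=
  ofAddSubgroup
    { carrier := {b | I.proj b ∈ K}
      zero_mem' := K.zero_mem
      add_mem' := fun ha hb => K.add_mem ha hb
      neg_mem' := fun ha => K.neg_mem ha }
    (fun b _ hx => K.lam_mem (I.proj b) hx)
    (fun b _ hx => K.add_conj_mem (I.proj b) hx)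
    (fun b _ hx => K.mul_conj_mem (I.proj b) hx)

/-- The ideal `J ∩ S` of a subbrace `S`, for an ideal `J` of `B`. -/
def restrict (J : BraceIdeal B) (S : Subbrace B) : BraceIdeal S :=
  ofAddSubgroup
    { carrier := {x | (x : B) ∈ J}
      zero_mem' := J.zero_mem
      add_mem' := fun ha hb => J.add_mem ha hb
      neg_mem' := fun ha => J.neg_mem ha }
    (fun b _ hx => J.lam_mem (b : B) hx)
    (fun b _ hx => J.add_conj_mem (b : B) hx)
    (fun b _ hx => J.mul_conj_mem (b : B) hx)

/-- The sum of a set of ideals: the subgroup of `(B,+)` generated by their union, which is an ideal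
(the zero ideal for the empty set). -/
def sum (𝒮 : Set (BraceIdeal B)) : BraceIdeal B :=
  have hlam : ∀ (b : B) {x : B}, x ∈ AddSubgroup.closure (⋃ I ∈ 𝒮, (I : Set B)) →
      lam b x ∈ AddSubgroup.closure (⋃ I ∈ 𝒮, (I : Set B)) := by
    intro b x hx
    induction hx using AddSubgroup.closure_induction with
    | mem x hx =>
      simp only [Set.mem_iUnion] at hx
      obtain ⟨I, hI, hx⟩ := hx
      exact AddSubgroup.subset_closure (Set.mem_biUnion hI (I.lam_mem b hx))
    | zero => rw [lam_zero]; exact AddSubgroup.zero_mem _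
    | add x y _ _ hx hy => rw [lam_add]; exact AddSubgroup.add_mem _ hx hy
    | neg x _ hx => rw [lam_neg]; exact AddSubgroup.neg_mem _ hx
  ofAddSubgroup (AddSubgroup.closure (⋃ I ∈ 𝒮, (I : Set B))) hlam
    (by
      intro b x hx
      induction hx using AddSubgroup.closure_induction with
      | mem x hx =>
        simp only [Set.mem_iUnion] at hx
        obtain ⟨I, hI, hx⟩ := hx
        exact AddSubgroup.subset_closure (Set.mem_biUnion hI (I.add_conj_mem b hx))
      | zero => simp
      | add x y _ _ hx hy =>
        have e : b + (x + y) + -b = (b + x + -b) + (b + y + -b) := by simp [add_assoc]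
        rw [e]; exact AddSubgroup.add_mem _ hx hy
      | neg x _ hx =>
        have e : b + -x + -b = -(b + x + -b) := by simp [add_assoc]
        rw [e]; exact AddSubgroup.neg_mem _ hx)
    (by
      intro b x hx
      suffices h : ∀ c d : B, d * lam c x * d⁻¹ ∈
          AddSubgroup.closure (⋃ I ∈ 𝒮, (I : Set B)) by
        simpa [lam_one] using h 1 b
      induction hx using AddSubgroup.closure_induction with
      | mem x hx =>
        intro c d
        simp only [Set.mem_iUnion] at hx
        obtain ⟨I, hI, hx⟩ := hx
        exact AddSubgroup.subset_closure
          (Set.mem_biUnion hI (I.mul_conj_mem d (I.lam_mem c hx)))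
      | zero => intro c d; simp [lam_zero, mul_zero', one_eq_zero]
      | add x y _ _ hx hy =>
        intro c d
        have e : d * lam c (x + y) * d⁻¹ = (d * lam c x * d⁻¹) *
            (d * lam ((lam c x)⁻¹ * c) y * d⁻¹) := by
          rw [lam_add, add_eq (lam c x), ← lam_mul]; group
        rw [e, mul_eq]
        exact AddSubgroup.add_mem _ (hx _ _) (hlam _ (hy _ _))
      | neg x _ hx =>
        intro c d
        have e : d * lam c (-x) * d⁻¹ = (d * lam ((lam c (-x))⁻¹ * c) x * d⁻¹)⁻¹ := by
          have h := inv_eq (lam c (-x))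
          rw [← lam_neg, ← lam_neg, neg_neg, ← lam_mul] at h
          rw [← h]; group
        rw [e, inv_eq]
        exact AddSubgroup.neg_mem _ (hlam _ (hx _ _)))

end BraceIdeal

namespace SkewBrace

/-- The socle `Soc(B) = Ker λ ∩ Z(B,+)`. -/
def socle (B : Type*) [SkewBrace B] : Set B :=
  {a | (∀ b : B, lam a b = b) ∧ ∀ b : B, a + b = b + a}

/-- The centre `ζ(B) = Soc(B) ∩ Z(B,·)`, an ideal of `B`. -/
def zeta (B : Type*) [SkewBrace B] : BraceIdeal B :=
  have key : ∀ {a : B}, (a ∈ socle B ∧ ∀ b : B, a * b = b * a) → ∀ b : B, lam b a = a := by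
    intro a ha b
    rw [lam, ← ha.2 b, mul_eq, ha.1.1 b, ha.1.2 b, neg_add_cancel_left]
  have lamadd : ∀ {a : B}, (a ∈ socle B ∧ ∀ b : B, a * b = b * a) → ∀ b : B, a * b = a + b := by
    intro a ha b
    rw [mul_eq, ha.1.1 b]
  BraceIdeal.ofAddSubgroup
    { carrier := {a | a ∈ socle B ∧ ∀ b : B, a * b = b * a}
      zero_mem' := by
        refine ⟨⟨fun b => ?_, fun b => ?_⟩, fun b => ?_⟩
        · rw [← one_eq_zero, lam_one]
        · simp
        · rw [zero_mul', mul_zero']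
      add_mem' := by
        intro a c ha hc
        have e : a + c = a * c := (lamadd ha c).symm
        refine ⟨⟨fun b => ?_, fun b => ?_⟩, fun b => ?_⟩
        · rw [e, lam_mul, hc.1.1, ha.1.1]
        · rw [add_assoc, hc.1.2, ← add_assoc, ha.1.2, add_assoc]
        · rw [e, mul_assoc, hc.2, ← mul_assoc, ha.2, mul_assoc]
      neg_mem' := by
        intro a ha
        have e : -a = a⁻¹ := by rw [inv_eq, key ha]
        refine ⟨⟨fun b => ?_, fun b => ?_⟩, fun b => ?_⟩
        · rw [e]
          conv_lhs => rw [← ha.1.1 b]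
          rw [← lam_mul, inv_mul_cancel, lam_one]
        · have h : AddCommute a b := ha.1.2 b
          exact h.neg_left
        · rw [e]
          have h : Commute a b := ha.2 b
          exact h.inv_left }
    (by
      intro b x hx
      rw [key hx b]
      exact hx)
    (by
      intro b x hx
      have e : b + x + -b = x := by rw [← hx.1.2 b, add_neg_cancel_right]
      rw [e]
      exact hx)
    (by
      intro b x hx
      have e : b * x * b⁻¹ = x := by rw [← hx.2 b, mul_inv_cancel_right]
      rw [e]
      exact hx)

/-- The finite terms of the upper central series: `ζ_0(B) = 0` and
`ζ_{n+1}(B)/ζ_n(B) = ζ(B/ζ_n(B))`. -/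
def zetaSeries (B : Type*) [SkewBrace B] : ℕ → BraceIdeal B
  | 0 => ⊥
  | n + 1 => (zetaSeries B n).preimage (zeta (zetaSeries B n).Quotient)

/-- `B` is centrally nilpotent if `B = ζ_m(B)` for some natural number `m`. -/
def IsCentrallyNilpotent (B : Type*) [SkewBrace B] : Prop :=
  ∃ m : ℕ, zetaSeries B m = ⊤

/-- `B` is supersoluble: there is a finite chain `0 = I_0 ≤ I_1 ≤ … ≤ I_n = B` of ideals of `B` such
that each factor `I_{i+1}/I_i` either has infinite cyclic additive group and is contained in
`Soc(B/I_i)`, or has prime order. -/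
def IsSupersoluble (B : Type*) [SkewBrace B] : Prop :=
  ∃ (n : ℕ) (I : ℕ → BraceIdeal B), I 0 = ⊥ ∧ I n = ⊤ ∧
    ∀ i < n, I i ≤ I (i + 1) ∧
      ((Infinite ((I (i + 1)).factor (I i)).toAddSubgroup ∧
          IsAddCyclic ((I (i + 1)).factor (I i)).toAddSubgroup ∧
          ((I (i + 1)).factor (I i) : Set (I i).Quotient) ⊆ socle (I i).Quotient) ∨
        (Nat.card ((I (i + 1)).factor (I i)).toAddSubgroup).Prime)

end SkewBrace

namespace BraceIdeal

variable {B : Type*} [SkewBrace B]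

/-- The ideal `I` of `B` is `B`-centrally nilpotent: there is a finite chain
`0 = J_0 ≤ J_1 ≤ … ≤ J_n = I` of ideals of `B` such that `J_{i+1}/J_i ≤ ζ(I/J_i)` for all `i < n`.
Here `I/J_i` is the quotient of the skew brace `I` by its ideal `J_i`. -/
def IsRelCentrallyNilpotent (I : BraceIdeal B) : Prop :=
  ∃ (n : ℕ) (J : ℕ → BraceIdeal B), J 0 = ⊥ ∧ J n = I ∧
    ∀ i < n, J i ≤ J (i + 1) ∧
      ((J (i + 1)).restrict I.toSubbrace).factor ((J i).restrict I.toSubbrace) ≤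
        SkewBrace.zeta ((J i).restrict I.toSubbrace).Quotient

variable (B) in
/-- The Fitting ideal of `B`: the sum of all `B`-centrally nilpotent ideals of `B`. -/
def fitting : BraceIdeal B := sum {I | I.IsRelCentrallyNilpotent}

end BraceIdeal

/-! Let `P = C (i + 1) / C i` be a factor of a supersoluble chain, and let `I` be the image in `B /
C i` of a centrally nilpotent ideal. The heart of the proof is that `I` centralizes `P`
(`IsSupersolubleFactor.centralizes`). Commutators between `P` and `I` lie in both ideals, so they
vanish if `P ∩ I = 0`. Otherwise nilpotency puts a nonzero central element of `I` inside `P`, and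
the cyclic structure of `P` spreads its centrality to all of `P`.

An ideal centralizing every factor is `B`-centrally nilpotent, through the chain `C i ⊓ I`
(`isRelCentrallyNilpotent_of_chain`). This gives claim 1. Centralizing a factor passes to arbitrary
sums of ideals, hence to the Fitting ideal, which gives claim 2. The two notions of nilpotency now
agree on ideals, so the two sums coincide. -/

namespace SkewBrace

/-! ### Commutators and centralizing elements -/

variable {B : Type*} [SkewBrace B]

/-- Two elements centralize each other if all their additive, multiplicative and `λ`-commutators
are trivial. -/
def Centralizes (a b : B) : Prop := lam a b = b ∧ a + b = b + a ∧ lam b a = a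

theorem Centralizes.symm {a b : B} (h : Centralizes a b) : Centralizes b a :=
  ⟨h.2.2, h.2.1.symm, h.1⟩

theorem lam_zero_left (a : B) : lam 0 a = a := by rw [← one_eq_zero, lam_one]

theorem centralizes_zero_left (a : B) : Centralizes 0 a :=
  ⟨lam_zero_left a, by simp, lam_zero a⟩

/-- Since `a * b = a + lam a b`, multiplicative commutation follows from the three conditions in
`Centralizes`; conversely it supplies the third one. -/
theorem mem_zeta_iff {a : B} : a ∈ zeta B ↔ ∀ b, Centralizes a b := by
  constructor
  · intro h b
    refine ⟨h.1.1 b, h.1.2 b, ?_⟩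
    rw [lam, ← h.2 b, mul_eq, h.1.1 b, h.1.2 b, neg_add_cancel_left]
  · intro h
    refine ⟨⟨fun b => (h b).1, fun b => (h b).2.1⟩, fun b => ?_⟩
    rw [mul_eq, mul_eq, (h b).1, (h b).2.1, (h b).2.2]

/-- The hypothesis `hy'` is needed because `x + y = x * lam x⁻¹ y`, so `lam (x + y)` factors through
`lam (lam x⁻¹ y)` rather than `lam y`. -/
theorem Centralizes.add_right {p x y : B} (hx : Centralizes p x) (hy : Centralizes p y)
    (hy' : Centralizes p (lam x⁻¹ y)) : Centralizes p (x + y) := by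
  refine ⟨by rw [lam_add, hx.1, hy.1], ?_, ?_⟩
  · rw [← add_assoc, hx.2.1, add_assoc, hy.2.1, add_assoc]
  · rw [add_eq, lam_mul, hy'.2.2, hx.2.2]

theorem centralizes_proj_iff (A : BraceIdeal B) (a b : B) :
    Centralizes (A.proj a) (A.proj b) ↔
      -b + lam a b ∈ A ∧ -(b + a) + (a + b) ∈ A ∧ -a + lam b a ∈ A := by
  rw [← A.proj_eq_proj, ← A.proj_eq_proj, ← A.proj_eq_proj]
  exact and_congr eq_comm (and_congr eq_comm eq_comm)

theorem commutators_mem_of_left (A : BraceIdeal B) {a : B} (ha : a ∈ A) (b : B) :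
    -b + lam a b ∈ A ∧ -(b + a) + (a + b) ∈ A ∧ -a + lam b a ∈ A := by
  rw [← centralizes_proj_iff]
  have : A.proj a = 0 := (A.proj_eq_proj.2 (by simpa using ha) : A.proj 0 = A.proj a).symm
  rw [this]
  exact centralizes_zero_left _

theorem commutators_mem_of_right (A : BraceIdeal B) (a : B) {b : B} (hb : b ∈ A) :
    -b + lam a b ∈ A ∧ -(b + a) + (a + b) ∈ A ∧ -a + lam b a ∈ A := by
  have h := (centralizes_proj_iff A b a).2 (commutators_mem_of_left A hb a)
  exact (centralizes_proj_iff A a b).1 h.symm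

theorem centralizes_of_commutators_eq_zero {a b : B} (h₁ : -b + lam a b = 0)
    (h₂ : -(b + a) + (a + b) = 0) (h₃ : -a + lam b a = 0) : Centralizes a b :=
  ⟨(neg_add_eq_zero.1 h₁).symm, (neg_add_eq_zero.1 h₂).symm, (neg_add_eq_zero.1 h₃).symm⟩

end SkewBrace

/-! ### Central filtrations and central elements -/

namespace BraceIdeal

variable {B : Type*} [SkewBrace B]

/-- `I` has a finite descending sequence of subsets, ending in zero, such that commutators of
elements of one of them with elements of `I` lie in the next one. -/
def HasCentralFiltration (I : BraceIdeal B) : Prop :=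
  ∃ (n : ℕ) (Z : ℕ → Set B), Z 0 ⊆ {0} ∧ (I : Set B) ⊆ Z n ∧
    ∀ k, ∀ z ∈ Z (k + 1), ∀ x ∈ I,
      -x + lam z x ∈ Z k ∧ -(x + z) + (z + x) ∈ Z k ∧ -z + lam x z ∈ Z k

theorem mem_zetaSeries_succ {n : ℕ} {z : B} :
    z ∈ zetaSeries B (n + 1) ↔ ∀ x, -x + lam z x ∈ zetaSeries B n ∧
      -(x + z) + (z + x) ∈ zetaSeries B n ∧ -z + lam x z ∈ zetaSeries B n := by
  change (zetaSeries B n).proj z ∈ zeta _ ↔ _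
  rw [mem_zeta_iff, (zetaSeries B n).proj_surjective.forall]
  exact forall_congr' fun x => centralizes_proj_iff _ z x

theorem hasCentralFiltration_of_isCentrallyNilpotent {I : BraceIdeal B}
    (h : IsCentrallyNilpotent I.toSubbrace) : I.HasCentralFiltration := by
  obtain ⟨n, hn⟩ := h
  refine ⟨n, fun k => Subtype.val '' (zetaSeries I.toSubbrace k : Set I.toSubbrace), ?_, ?_, ?_⟩
  · rintro _ ⟨z, hz, rfl⟩
    have hz : z = 0 := hz
    rw [hz]
    rfl
  · intro x hx
    refine ⟨⟨x, hx⟩, ?_, rfl⟩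
    rw [hn]
    trivial
  · rintro k _ ⟨z, hz, rfl⟩ x hx
    obtain ⟨h₁, h₂, h₃⟩ := mem_zetaSeries_succ.1 hz ⟨x, hx⟩
    exact ⟨⟨_, h₁, rfl⟩, ⟨_, h₂, rfl⟩, ⟨_, h₃, rfl⟩⟩

/-- As the terms of a filtration are mere subsets, their images in `B/A` need no closure properties.
-/
theorem HasCentralFiltration.factor {I : BraceIdeal B} (h : I.HasCentralFiltration)
    (A : BraceIdeal B) : (I.factor A).HasCentralFiltration := by
  obtain ⟨n, Z, h₀, hn, hZ⟩ := h
  refine ⟨n, fun k => A.proj '' Z k, ?_, ?_, ?_⟩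
  · rintro _ ⟨z, hz, rfl⟩
    rw [h₀ hz]
    rfl
  · rintro _ ⟨x, hx, rfl⟩
    exact ⟨x, hn hx, rfl⟩
  · rintro k _ ⟨z, hz, rfl⟩ _ ⟨x, hx, rfl⟩
    obtain ⟨h₁, h₂, h₃⟩ := hZ k z hz x hx
    exact ⟨⟨_, h₁, rfl⟩, ⟨_, h₂, rfl⟩, ⟨_, h₃, rfl⟩⟩

/-- An ideal meeting an ideal `I` with a central filtration nontrivially contains a nonzero central
element of `I`. -/
theorem HasCentralFiltration.exists_centralizes {I : BraceIdeal B} (h : I.HasCentralFiltration)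
    (P : BraceIdeal B) {p : B} (hpP : p ∈ P) (hpI : p ∈ I) (hp : p ≠ 0) :
    ∃ q ∈ P, q ∈ I ∧ q ≠ 0 ∧ ∀ x ∈ I, Centralizes q x := by
  obtain ⟨n, Z, h₀, hn, hZ⟩ := h
  have key : ∀ k, ∀ p ∈ P, p ∈ I → p ≠ 0 → p ∈ Z k →
      ∃ q ∈ P, q ∈ I ∧ q ≠ 0 ∧ ∀ x ∈ I, Centralizes q x := by
    -- Either `p` already centralizes `I`, or some commutator of `p` with `I` is a nonzero element
    -- of `P ∩ I` one level lower.
    intro k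
    induction k with
    | zero => exact fun p _ _ hp hz => absurd (h₀ hz) hp
    | succ k ih =>
      intro p hpP hpI hp hz
      by_contra hcon
      refine hcon ⟨p, hpP, hpI, hp, fun x hx => ?_⟩
      have hc := hZ k p hz x hx
      have hP := commutators_mem_of_left P hpP x
      have hI := commutators_mem_of_left I hpI x
      have aux : ∀ c ∈ P, c ∈ I → c ∈ Z k → c = 0 := fun c h₁ h₂ h₃ => by
        by_contra hc
        exact hcon (ih c h₁ h₂ hc h₃)
      exact centralizes_of_commutators_eq_zero (aux _ hP.1 hI.1 hc.1)
        (aux _ hP.2.1 hI.2.1 hc.2.1) (aux _ hP.2.2 hI.2.2 hc.2.2)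
  exact key n p hpP hpI hp (hn hpI)

/-- Additive multiples of an element of `I` centralizing `I` centralize `I`. -/
theorem centralizes_zsmul {I : BraceIdeal B} {q : B} (hqI : q ∈ I)
    (hq : ∀ x ∈ I, Centralizes q x) (m : ℤ) {x : B} (hx : x ∈ I) : Centralizes (m • q) x := by
  -- The centre of the brace `I` is an ideal, so it is closed under additive multiples.
  have hz : (⟨q, hqI⟩ : I.toSubbrace) ∈ zeta I.toSubbrace := mem_zeta_iff.2 fun y =>
    have h := hq y y.2
    ⟨Subtype.ext h.1, Subtype.ext h.2.1, Subtype.ext h.2.2⟩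
  have hm : m • (⟨q, hqI⟩ : I.toSubbrace) ∈ zeta I.toSubbrace :=
    (zeta I.toSubbrace).toAddSubgroup.zsmul_mem hz m
  have hval : ((m • (⟨q, hqI⟩ : I.toSubbrace) : I.toSubbrace) : B) = m • q :=
    map_zsmul (⟨⟨Subtype.val, rfl⟩, fun _ _ => rfl⟩ : I.toSubbrace →+ B) m _
  have h := mem_zeta_iff.1 hm ⟨x, hx⟩
  rw [← hval]
  exact ⟨congrArg Subtype.val h.1, congrArg Subtype.val h.2.1, congrArg Subtype.val h.2.2⟩

theorem lam_zsmul (b x : B) (m : ℤ) : lam b (m • x) = m • lam b x :=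
  map_zsmul (⟨⟨lam b, lam_zero b⟩, lam_add b⟩ : B →+ B) m x

/-! ### Nilpotent ideals centralize supersoluble factors -/

/-- The factors allowed in a chain witnessing supersolubility. -/
def IsSupersolubleFactor (P : BraceIdeal B) : Prop :=
  (Infinite P.toAddSubgroup ∧ IsAddCyclic P.toAddSubgroup ∧ (P : Set B) ⊆ socle B) ∨
    (Nat.card P.toAddSubgroup).Prime

theorem IsSupersolubleFactor.centralizes {P I : BraceIdeal B} (hP : P.IsSupersolubleFactor)
    (hI : I.HasCentralFiltration) {p x : B} (hp : p ∈ P) (hx : x ∈ I) : Centralizes p x := by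
  by_cases htriv : ∀ c ∈ P, c ∈ I → c = 0
  · have h₁ := commutators_mem_of_left P hp x
    have h₂ := commutators_mem_of_right I p hx
    exact centralizes_of_commutators_eq_zero (htriv _ h₁.1 h₂.1)
      (htriv _ h₁.2.1 h₂.2.1) (htriv _ h₁.2.2 h₂.2.2)
  push Not at htriv
  obtain ⟨c, hcP, hcI, hc⟩ := htriv
  obtain ⟨q, hqP, hqI, hq, hqc⟩ := hI.exists_centralizes P hcP hcI hc
  rcases hP with ⟨hinf, hcyc, hsoc⟩ | hprime
  -- The socle gives all but `lam x p = p`. If `g` generates `P` and `lam x g = k • g`, then fixing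
  -- `q = m • g ≠ 0` forces `k = 1`.
  · refine ⟨(hsoc hp).1 x, (hsoc hp).2 x, ?_⟩
    obtain ⟨⟨g, hgP⟩, hg⟩ := hcyc.exists_generator
    have hgen : ∀ y ∈ P, ∃ m : ℤ, m • g = y := fun y hy => by
      obtain ⟨m, hm⟩ := AddSubgroup.mem_zmultiples_iff.1 (hg ⟨y, hy⟩)
      exact ⟨m, congrArg Subtype.val hm⟩
    have hord : ∀ m : ℤ, m • g = 0 → m = 0 := by
      have h₀ : addOrderOf (⟨g, hgP⟩ : P.toAddSubgroup) = 0 :=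
        Infinite.addOrderOf_eq_zero_of_forall_mem_zmultiples hg
      intro m hm
      have h₁ : m • (⟨g, hgP⟩ : P.toAddSubgroup) = 0 := Subtype.ext hm
      have h₂ := addOrderOf_dvd_iff_zsmul_eq_zero.2 h₁
      rw [h₀] at h₂
      simpa using h₂
    obtain ⟨m, rfl⟩ := hgen q hqP
    obtain ⟨k, hk⟩ := hgen (lam x g) (P.lam_mem x hgP)
    obtain ⟨l, rfl⟩ := hgen p hp
    have hm : m ≠ 0 := by
      rintro rfl
      simp at hq
    have h := (hqc x hx).2.2
    rw [lam_zsmul, ← hk, ← mul_zsmul', ← sub_eq_zero, sub_eq_add_neg, ← neg_zsmul,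
      ← add_zsmul] at h
    have hk₁ : k = 1 := by
      have h' := hord _ h
      have : m * (k - 1) = 0 := by linear_combination h'
      have := (mul_eq_zero.1 this).resolve_left hm
      omega
    rw [lam_zsmul, ← hk, hk₁, one_zsmul]
  -- In prime order any nonzero element generates, so `p` is an additive multiple of `q`.
  · have : Fact (Nat.card P.toAddSubgroup).Prime := ⟨hprime⟩
    have hq' : (⟨q, hqP⟩ : P.toAddSubgroup) ≠ 0 := fun h => hq (congrArg Subtype.val h)
    have hmem : (⟨p, hp⟩ : P.toAddSubgroup) ∈ AddSubgroup.zmultiples ⟨q, hqP⟩ :=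
      mem_zmultiples_of_prime_card rfl hq'
    obtain ⟨m, hm⟩ := AddSubgroup.mem_zmultiples_iff.1 hmem
    have hm : m • q = p := congrArg Subtype.val hm
    rw [← hm]
    exact centralizes_zsmul hqI hqc m hx

/-! ### Passage to sums of ideals -/

/-- Summands are appended on the right one at a time, the form in which `Centralizes.add_right`
applies. -/
theorem mem_sum_induction {𝒮 : Set (BraceIdeal B)} {C : B → Prop} (zero : C 0)
    (add : ∀ x, ∀ I ∈ 𝒮, ∀ y ∈ I, C x → C (x + y)) {x : B} (hx : x ∈ sum 𝒮) : C x := by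
  change x ∈ AddSubgroup.closure (⋃ I ∈ 𝒮, (I : Set B)) at hx
  induction hx using AddSubgroup.closure_induction_right with
  | zero => exact zero
  | add_right x _ y hy ih =>
    simp only [Set.mem_iUnion] at hy
    obtain ⟨I, hI, hy⟩ := hy
    exact add x I hI y hy ih
  | add_neg_cancel x _ y hy ih =>
    simp only [Set.mem_iUnion] at hy
    obtain ⟨I, hI, hy⟩ := hy
    exact add x I hI (-y) (I.neg_mem hy) ih

theorem centralizes_proj_of_mem_sum {A P : BraceIdeal B} {𝒮 : Set (BraceIdeal B)}
    (h : ∀ I ∈ 𝒮, ∀ p ∈ P, ∀ x ∈ I, Centralizes (A.proj p) (A.proj x)) {p x : B}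
    (hp : p ∈ P) (hx : x ∈ sum 𝒮) : Centralizes (A.proj p) (A.proj x) := by
  refine mem_sum_induction (C := fun x => Centralizes (A.proj p) (A.proj x))
    (centralizes_zero_left _).symm (fun x I hI y hy hx => ?_) hx
  exact hx.add_right (h I hI p hp y hy) (h I hI p hp _ (I.lam_mem x⁻¹ hy))

/-! ### From centralized chains to nilpotency -/

/-- The intersection of two ideals. -/
instance : Min (BraceIdeal B) := ⟨fun I J => ofAddSubgroup (I.toAddSubgroup ⊓ J.toAddSubgroup)
  (fun b _ hx => ⟨I.lam_mem b hx.1, J.lam_mem b hx.2⟩)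
  (fun b _ hx => ⟨I.add_conj_mem b hx.1, J.add_conj_mem b hx.2⟩)
  (fun b _ hx => ⟨I.mul_conj_mem b hx.1, J.mul_conj_mem b hx.2⟩)⟩

theorem mem_inf {I J : BraceIdeal B} {x : B} : x ∈ I ⊓ J ↔ x ∈ I ∧ x ∈ J := Iff.rfl

/-- Centrality in a quotient of the brace `I` becomes a statement about commutators in `B`. -/
theorem factor_restrict_le_zeta_iff {I J K : BraceIdeal B} :
    (K.restrict I.toSubbrace).factor (J.restrict I.toSubbrace) ≤
        zeta (J.restrict I.toSubbrace).Quotient ↔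
      ∀ z ∈ K, z ∈ I → ∀ x ∈ I,
        -x + lam z x ∈ J ∧ -(x + z) + (z + x) ∈ J ∧ -z + lam x z ∈ J := by
  constructor
  · intro h z hzK hzI x hx
    have hz := mem_zeta_iff.1 (h ⟨⟨z, hzI⟩, hzK, rfl⟩)
      ((J.restrict I.toSubbrace).proj ⟨x, hx⟩)
    exact (centralizes_proj_iff (J.restrict I.toSubbrace) _ _).1 hz
  · rintro h _ ⟨z, hz, rfl⟩
    rw [mem_zeta_iff, (J.restrict I.toSubbrace).proj_surjective.forall]
    intro x
    exact (centralizes_proj_iff _ _ _).2 (h z hz z.2 x x.2)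

/-- If `I` centralizes all the factors of a finite chain of ideals of `B`, then `I` is
`B`-centrally nilpotent. -/
theorem isRelCentrallyNilpotent_of_chain {I : BraceIdeal B} {n : ℕ} {C : ℕ → BraceIdeal B}
    (h₀ : C 0 = ⊥) (hn : C n = ⊤)
    (hC : ∀ i < n, C i ≤ C (i + 1) ∧
      ∀ p ∈ C (i + 1), ∀ x ∈ I, Centralizes ((C i).proj p) ((C i).proj x)) :
    I.IsRelCentrallyNilpotent := by
  refine ⟨n, fun i => C i ⊓ I, ?_, ?_, fun i hi => ⟨?_, ?_⟩⟩
  · refine SetLike.ext fun x => ?_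
    rw [mem_inf, h₀]
    refine ⟨fun h => h.1, fun h => ⟨h, ?_⟩⟩
    have h : x = 0 := h
    rw [h]
    exact I.zero_mem
  · refine SetLike.ext fun x => ?_
    rw [mem_inf, hn]
    exact ⟨fun h => h.2, fun h => ⟨trivial, h⟩⟩
  · exact fun x hx => ⟨(hC i hi).1 hx.1, hx.2⟩
  · rw [factor_restrict_le_zeta_iff]
    intro z hz hzI x hx
    have h₁ := (centralizes_proj_iff _ _ _).1 ((hC i hi).2 z hz.1 x hx)
    have h₂ := commutators_mem_of_left I hzI x
    exact ⟨⟨h₁.1, h₂.1⟩, ⟨h₁.2.1, h₂.2.1⟩, ⟨h₁.2.2, h₂.2.2⟩⟩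

/-- A central chain of `I` lies termwise below its upper central series. -/
theorem IsRelCentrallyNilpotent.isCentrallyNilpotent {I : BraceIdeal B}
    (h : I.IsRelCentrallyNilpotent) : IsCentrallyNilpotent I.toSubbrace := by
  obtain ⟨n, J, h₀, hn, hJ⟩ := h
  have key : ∀ i ≤ n, ∀ z : I.toSubbrace, (z : B) ∈ J i → z ∈ zetaSeries I.toSubbrace i := by
    intro i
    induction i with
    | zero =>
      intro _ z hz
      rw [h₀] at hz
      exact Subtype.ext (hz : (z : B) = 0)
    | succ i ih =>
      intro hi z hz
      refine mem_zetaSeries_succ.2 fun x => ?_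
      obtain ⟨h₁, h₂, h₃⟩ := factor_restrict_le_zeta_iff.1 (hJ i hi).2 z hz z.2 x x.2
      exact ⟨ih (by omega) _ h₁, ih (by omega) _ h₂, ih (by omega) _ h₃⟩
  refine ⟨n, SetLike.ext fun z => ⟨fun _ => trivial, fun _ => key n le_rfl z ?_⟩⟩
  rw [hn]
  exact z.2

end BraceIdeal

theorem theorem3p32 {B : Type*} [SkewBrace B] (hB : SkewBrace.IsSupersoluble B) :
    (∀ I : BraceIdeal B, SkewBrace.IsCentrallyNilpotent I.toSubbrace →
      I.IsRelCentrallyNilpotent) ∧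
    SkewBrace.IsCentrallyNilpotent (BraceIdeal.fitting B).toSubbrace ∧
    BraceIdeal.fitting B =
      BraceIdeal.sum {I : BraceIdeal B | SkewBrace.IsCentrallyNilpotent I.toSubbrace} := by
  obtain ⟨n, C, h₀, hn, hC⟩ := hB
  have key : ∀ i < n, ∀ I : BraceIdeal B, IsCentrallyNilpotent I.toSubbrace →
      ∀ p ∈ C (i + 1), ∀ x ∈ I, Centralizes ((C i).proj p) ((C i).proj x) :=
    fun i hi I hI p hp x hx =>
      BraceIdeal.IsSupersolubleFactor.centralizes (hC i hi).2
        ((BraceIdeal.hasCentralFiltration_of_isCentrallyNilpotent hI).factor (C i))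
        ⟨p, hp, rfl⟩ ⟨x, hx, rfl⟩
  have hrel : ∀ I : BraceIdeal B, IsCentrallyNilpotent I.toSubbrace →
      I.IsRelCentrallyNilpotent := fun I hI =>
    BraceIdeal.isRelCentrallyNilpotent_of_chain h₀ hn
      fun i hi => ⟨(hC i hi).1, key i hi I hI⟩
  refine ⟨hrel, ?_, ?_⟩
  -- The length of the chain `C` bounds the nilpotency class independently of the number of
  -- summands, so the sum may be infinite.
  · refine BraceIdeal.IsRelCentrallyNilpotent.isCentrallyNilpotent
      (BraceIdeal.isRelCentrallyNilpotent_of_chain h₀ hn fun i hi => ⟨(hC i hi).1, ?_⟩)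
    exact fun p hp x hx => BraceIdeal.centralizes_proj_of_mem_sum
      (fun I hI => key i hi I hI.isCentrallyNilpotent) hp hx
  · exact congrArg BraceIdeal.sum
      (Set.ext fun I => ⟨fun hI => hI.isCentrallyNilpotent, hrel I⟩)
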